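/- Let $X$ be a variety over $\mathbb{C}$ (an integral separated scheme of finite type), $n=\dim X$, let $L$ be a line bundle on $X$, and let $W_\bullet=\{W_k\}_{k\ge 0}$ be a graded linear series associated to $L$: each $W_k$ is a (possibly infinite-dimensional) linear subspace of $H^0(X,L^{\otimes k})$, $W_0=\mathbb{C}$, and $\bigoplus_k W_k$ is a graded subalgebra of $\bigoplus_k H^0(X,L^{\otimes k})$. Assume that $W_\bullet$ is birational, i.e. for every $k\gg 0$ the function field $K(X)$ is generated over $\mathbb{C}$ as a field by $\{f/g : f,g\in W_k,\ g\neq 0\}$; if $n=0$, assume moreover that $W_k\ne 0$ for all $k\gg 0$ (this is automatic if $n\geq 1$). Let $p\in X$ be a smooth closed point, let $z=(z_1,\dots,z_n)$ be a local coordinate system at $p$ (elements of $\mathcal{O}_{X,p}$ generating the maximal ideal), and let $>$ be a monomial order on $\mathbb{N}^n$ (a total order such that $u>0$ for all $u\neq 0$, and $v>u$ implies $w+v>w+u$). For $0\neq f\in\mathcal{O}_{X,p}$ with power series expansion $f=\sum_u c_u z^u$ put $\nu(f)=\min_{>}\{u : c_u\neq 0\}$. Fix an isomorphism $L_p\cong\mathcal{O}_{X,p}$;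 it induces $L_p^{\otimes k}\cong\mathcal{O}_{X,p}$ for all $k$. Let $\nu(W_k)\subset\mathbb{N}^n$ be the set of values of $\nu$ on the elements of $W_k\setminus\{0\}$, regarded as elements of $\mathcal{O}_{X,p}$, and let $$\Gamma=\Gamma_{W_\bullet,z,>}=\bigcup_{k\in\mathbb{N}}\{k\}\times\nu(W_k)\subset\mathbb{N}\times\mathbb{N}^n .$$ Then $\Gamma$ is a birational semigroup, i.e. $\Gamma$ is closed under addition, $\{u\in\mathbb{N}^n : (0,u)\in\Gamma\}=\{0\}$, and $\Gamma$ generates $\mathbb{Z}\times\mathbb{Z}^n$ as a group. -/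

import Mathlib

open AlgebraicGeometry CategoryTheory Filter
open scoped TensorProduct MonomialOrder

noncomputable section

namespace GradedSeries

/-- A complex variety: an integral separated scheme of finite type over `ℂ`. -/
class IsComplexVariety (X : Scheme.{0}) [X.Over (Spec (.of ℂ))] : Prop where
  isIntegral : IsIntegral X
  isSeparated : IsSeparated (X ↘ Spec (.of ℂ))
  locallyOfFiniteType : LocallyOfFiniteType (X ↘ Spec (.of ℂ))
  quasiCompact : QuasiCompact (X ↘ Spec (.of ℂ))

attribute [instance] IsComplexVariety.isIntegral IsComplexVariety.isSeparated
  IsComplexVariety.locallyOfFiniteType IsComplexVariety.quasiCompact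

/-- The local rings of a scheme over `ℂ` are `ℂ`-algebras: a constant is sent to the germ of its
image under `ℂ → Γ(Spec ℂ) → Γ(X)`. At the generic point this is the structure of a field extension
of `ℂ` on the function field. -/
instance stalkAlgebra (X : Scheme.{0}) [X.Over (Spec (.of ℂ))] (x : X) :
    Algebra ℂ (X.presheaf.stalk x) :=
  ((X.presheaf.germ ⊤ x trivial).hom.comp
    ((X ↘ Spec (.of ℂ)).appTop.hom.comp (Scheme.ΓSpecIso (.of ℂ)).inv.hom)).toAlgebra

section LineBundle

variable {X : Scheme.{0}}

/-- The stalk of a sheaf of modules. -/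
abbrev Stalk (L : X.Modules) (x : X) : Type := ↑(TopCat.Presheaf.stalk L.presheaf x : Ab.{0})

instance stalkModule (L : X.Modules) (x : X) : Module (X.presheaf.stalk x) (Stalk L x) :=
  PresheafOfModules.instModuleCarrierStalkCommRingCatCarrierAbPresheafOpensCarrier
    (R := X.presheaf) L.val x

/-- A line bundle (invertible sheaf): a sheaf of modules that is locally isomorphic to `𝒪_X`. -/
def IsLineBundle (L : X.Modules) : Prop :=
  ∀ x : X, ∃ U : X.Opens, x ∈ U ∧
    Nonempty (L.restrict U.ι ≅ SheafOfModules.unit U.toScheme.ringCatSheaf)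

/-- The stalk at `x` of the tensor power `L^{⊗ k}`, i.e. the `k`-th tensor power of the stalk of `L`
over the local ring at `x`. -/
abbrev PowStalk (L : X.Modules) (k : ℕ) (x : X) : Type :=
  ⨂[X.presheaf.stalk x]^k (Stalk L x)

/-- The element `∑ j, a j • (t j 0 ⊗ ⋯ ⊗ t j (k-1))` of the tensor power `Γ(L, U)^{⊗ k}` over
`Γ(X, U)`, as an element of the stalk of `L^{⊗ k}` at the point `y` of `U`. -/
def germTensor (L : X.Modules) {k m : ℕ} {U : X.Opens} (a : Fin m → Γ(X, U))
    (t : Fin m → Fin k → Γ(L, U)) (y : X) (hy : y ∈ U) : PowStalk L k y :=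
  ∑ j, X.presheaf.germ U y hy (a j) •
    PiTensorProduct.tprod (X.presheaf.stalk y)
      (fun i => (TopCat.Presheaf.germ L.presheaf U y hy (t j i) : Stalk L y))

variable [X.Over (Spec (.of ℂ))]

/-- `H⁰(X, L^{⊗ k})`. As `L^{⊗ k}` is the sheaf associated with the presheaf
`U ↦ Γ(L, U)^{⊗ k}`, its global sections are the families of elements of the stalks that are locally
induced by elements of `Γ(L, U)^{⊗ k}`. -/
def powSections (L : X.Modules) (k : ℕ) : Submodule ℂ (∀ x : X, PowStalk L k x) where
  carrier := {s | ∀ x : X, ∃ U : X.Opens, x ∈ U ∧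
    ∃ (m : ℕ) (a : Fin m → Γ(X, U)) (t : Fin m → Fin k → Γ(L, U)),
      ∀ (y : X) (hy : y ∈ U), s y = germTensor L a t y hy}
  add_mem' := by
    intro s s' hs hs' x
    obtain ⟨U, hxU, m, a, t, h⟩ := hs x
    obtain ⟨U', hxU', m', a', t', h'⟩ := hs' x
    refine ⟨U ⊓ U', ⟨hxU, hxU'⟩, m + m',
      Fin.append (fun j => X.presheaf.map (homOfLE inf_le_left).op (a j))
        (fun j => X.presheaf.map (homOfLE inf_le_right).op (a' j)),
      Fin.append (fun j i => L.presheaf.map (homOfLE inf_le_left).op (t j i))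
        (fun j i => L.presheaf.map (homOfLE inf_le_right).op (t' j i)), ?_⟩
    intro y hy
    rw [Pi.add_apply, h y hy.1, h' y hy.2]
    simp only [germTensor, Fin.sum_univ_add, Fin.append_left, Fin.append_right]
    congr 1 <;> refine Finset.sum_congr rfl fun j _ => ?_
    · rw [TopCat.Presheaf.germ_res_apply]
      congr 2
      funext i
      exact (TopCat.Presheaf.germ_res_apply L.presheaf (homOfLE inf_le_left) y hy _).symm
    · rw [TopCat.Presheaf.germ_res_apply]
      congr 2
      funext i
      exact (TopCat.Presheaf.germ_res_apply L.presheaf (homOfLE inf_le_right) y hy _).symm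
  zero_mem' := fun x => ⟨⊤, trivial, 0, Fin.elim0, Fin.elim0, fun y hy => by simp [germTensor]⟩
  smul_mem' := by
    intro c s hs x
    obtain ⟨U, hxU, m, a, t, h⟩ := hs x
    refine ⟨U, hxU, m, fun j => X.presheaf.map (homOfLE le_top).op
      ((X ↘ Spec (.of ℂ)).appTop.hom ((Scheme.ΓSpecIso (.of ℂ)).inv.hom c)) * a j, t, ?_⟩
    intro y hy
    rw [Pi.smul_apply, h y hy, ← algebraMap_smul (X.presheaf.stalk y) c]
    simp only [germTensor, Finset.smul_sum, smul_smul, map_mul]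
    refine Finset.sum_congr rfl fun j _ => ?_
    rw [TopCat.Presheaf.germ_res_apply]
    rfl

/-- A graded linear series `W_•` associated to `L`: subspaces `W_k` of `H⁰(X, L^{⊗ k})` such that
`W_0 = ℂ` and `⨁ W_k` is a graded subalgebra of the section ring of `L`. -/
structure GradedLinearSeries (L : X.Modules) where
  W : ∀ k : ℕ, Submodule ℂ (∀ x : X, PowStalk L k x)
  le_sections : ∀ k, W k ≤ powSections L k
  zero_eq : W 0 = Submodule.span ℂ
    {((fun _ => TensorPower.algebraMap₀ 1) : ∀ x : X, PowStalk L 0 x)}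
  mul_mem : ∀ {j k : ℕ} {s : ∀ x, PowStalk L j x} {t : ∀ x, PowStalk L k x},
    s ∈ W j → t ∈ W k →
      (fun x => TensorPower.mulEquiv (s x ⊗ₜ[X.presheaf.stalk x] t x)) ∈ W (j + k)

/-- The set of all `f / g ∈ K(X)` with `f, g ∈ W_k`, `g ≠ 0`; here `f / g` is the rational function
`c` with `f = c g` at the generic point. -/
def GradedLinearSeries.ratios [IsIntegral X] {L : X.Modules} (W : GradedLinearSeries L) (k : ℕ) :
    Set X.functionField :=
  {c | ∃ f ∈ W.W k, ∃ g ∈ W.W k, g ≠ 0 ∧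
    f (genericPoint X) = (c : X.presheaf.stalk (genericPoint X)) • g (genericPoint X)}

/-- `W_•` is birational if, for all `k ≫ 0`, the ratios of elements of `W_k` generate `K(X)` as a
field over `ℂ`. -/
def GradedLinearSeries.IsBirational [IsIntegral X] {L : X.Modules} (W : GradedLinearSeries L) :
    Prop :=
  ∀ᶠ k in atTop, IntermediateField.adjoin ℂ (W.ratios k) = ⊤

end LineBundle

section Valuation

variable {X : Scheme.{0}} [X.Over (Spec (.of ℂ))] {n : ℕ}

/-- A smooth (closed) point of `X`. -/
def IsSmoothPoint (p : X) : Prop :=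
  IsClosed {p} ∧ ∃ U : X.Opens, p ∈ U ∧ Smooth (U.ι ≫ (X ↘ Spec (.of ℂ)))

/-- Elements `z_1, …, z_n` of the local ring at `p`, where `n` is the dimension of `X`, form a local
coordinate system at `p` if they generate the maximal ideal. -/
def IsLocalCoordinates (p : X) (z : Fin n → X.presheaf.stalk p) : Prop :=
  topologicalKrullDim X = n ∧
    Ideal.span (Set.range z) = IsLocalRing.maximalIdeal (X.presheaf.stalk p)

/-- `F = ∑ c_u z^u` is the power series expansion of `f ∈ 𝒪_{X,p}`: for every `N`, the terms of
degree less than `N` add up to `f` modulo the `N`-th power of the maximal ideal. -/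
def IsExpansion {p : X} (z : Fin n → X.presheaf.stalk p) (f : X.presheaf.stalk p)
    (F : MvPowerSeries (Fin n) ℂ) : Prop :=
  ∀ N : ℕ, f - ∑ d ∈ Finset.range N, ∑ u ∈ Finset.finsuppAntidiag Finset.univ d,
      algebraMap ℂ (X.presheaf.stalk p) (MvPowerSeries.coeff u F) * ∏ i, z i ^ u i
    ∈ IsLocalRing.maximalIdeal (X.presheaf.stalk p) ^ N

/-- `ν_{z,>}(f) = u`: the exponent `u` is the least one, for the monomial order, that occurs in the
power series expansion of `f`. -/
def IsValue (ord : MonomialOrder (Fin n)) {p : X} (z : Fin n → X.presheaf.stalk p)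
    (f : X.presheaf.stalk p) (u : Fin n →₀ ℕ) : Prop :=
  ∃ F : MvPowerSeries (Fin n) ℂ, IsExpansion z f F ∧
    MvPowerSeries.coeff u F ≠ 0 ∧ ∀ v, MvPowerSeries.coeff v F ≠ 0 → u ≼[ord] v

/-- The map `L_p^{⊗ k} → 𝒪_{X,p}`, `t_1 ⊗ ⋯ ⊗ t_k ↦ φ(t_1) ⋯ φ(t_k)`, induced by
`φ : L_p ≅ 𝒪_{X,p}`. -/
def powTrivialization {L : X.Modules} {p : X}
    (φ : Stalk L p ≃ₗ[X.presheaf.stalk p] X.presheaf.stalk p) (k : ℕ) :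
    PowStalk L k p →ₗ[X.presheaf.stalk p] X.presheaf.stalk p :=
  PiTensorProduct.lift
    ((MultilinearMap.mkPiAlgebra (X.presheaf.stalk p) (Fin k) (X.presheaf.stalk p)).compLinearMap
      fun _ => φ.toLinearMap)

/-- `Γ_{W_•,z,>} = ⋃ k, {k} × ν(W_k)`, where `ν(W_k)` is the set of the values of the nonzero
elements of `W_k`, regarded as elements of `𝒪_{X,p}` through `φ`. -/
def GradedLinearSeries.valueSemigroup {L : X.Modules} (W : GradedLinearSeries L)
    (ord : MonomialOrder (Fin n)) {p : X} (z : Fin n → X.presheaf.stalk p)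
    (φ : Stalk L p ≃ₗ[X.presheaf.stalk p] X.presheaf.stalk p) : Set (ℕ × (Fin n →₀ ℕ)) :=
  {a | ∃ s ∈ W.W a.1, s ≠ 0 ∧ IsValue ord z (powTrivialization φ a.1 (s p)) a.2}

end Valuation

/-- The inclusion of `ℕ × ℕ^n` into `ℤ × ℤ^n`. -/
def toIntProd {n : ℕ} (a : ℕ × (Fin n →₀ ℕ)) : ℤ × (Fin n → ℤ) :=
  ((a.1 : ℤ), fun i => (a.2 i : ℤ))

/-- A birational semigroup in `ℕ × ℕ^n`. -/
structure IsBirationalSemigroup {n : ℕ} (S : Set (ℕ × (Fin n →₀ ℕ))) : Prop where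
  add_mem : ∀ a ∈ S, ∀ b ∈ S, a + b ∈ S
  degree_zero : {u | (0, u) ∈ S} = {0}
  generates : AddSubgroup.closure (toIntProd '' S) = ⊤

end GradedSeries

end
open GradedSeries

/-!
The coordinates `z` give every element `f` of the local ring `A` at `p` a power series expansion,
since the residue field is `ℂ`. The expansion is unique. The dimension of the variety is at most the
dimension of the space of differentials of its function field
(`ringKrullDim_le_finrank_kaehlerDifferential`, by Noether normalization), while by Nakayama's lemma
the `n` differentials `dz_i` span the differentials of `A`; hence they form a basis, and `A` carries
derivations `∂_i` with `∂_i z_j = δ_ij` (`isCoordinateSystem_of_le_finrank`). Differentiating an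
expansion of `0` term by term shows in characteristic zero that all its coefficients vanish
(`HasExpansion.eq_zero`). Consequently the least exponent of an expansion is a well-defined
valuation, with values `0` on constants and `e_i` on `z_i`.

In a local trivialization of the line bundle, sections of its powers become functions, so on an
integral scheme they are determined by their germ at `p`, and the ratios of elements of `W_k` may be
computed in `A` (`GradedLinearSeries.ratios_eq`). The quotients of elements of equal degree of a
graded algebra form a field (`quotientField`); if the series is birational, this field is the whole
function field. So each `z_i` is a quotient `f / g` with `f`, `g` in the same `W_d`, and
`(0, e_i) = (d, ν f) - (d, ν g)` lies in the group generated by the semigroup. Two nonzero elements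
of consecutive degrees yield an element of degree one, and together these generate `ℤ × ℤ^n`
(`isBirationalSemigroup_values`).
-/

namespace GradedSeries

/-! ### Power series expansions in a local algebra -/

section Expansion

variable {k A : Type*} [Field k] [CommRing A] [IsLocalRing A] [Algebra k A] {n : ℕ}

/-- `F` is a power series expansion of `f` with respect to the elements `z_1, …, z_n` of the local
`k`-algebra `A`: the terms of `F` of degree less than `N` add up to `f` modulo the `N`-th power of
the maximal ideal. -/
def HasExpansion (z : Fin n → A) (f : A) (F : MvPowerSeries (Fin n) k) : Prop :=
  ∀ N : ℕ, f - ∑ d ∈ Finset.range N, ∑ u ∈ Finset.finsuppAntidiag Finset.univ d,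
      algebraMap k A (MvPowerSeries.coeff u F) * ∏ i, z i ^ u i ∈ IsLocalRing.maximalIdeal A ^ N

variable {z : Fin n → A}

/-- A polynomial without terms of degree less than `N` takes a value in the `N`-th power of the
maximal ideal. -/
lemma aeval_mem_maximalIdeal_pow (hz : ∀ i, z i ∈ IsLocalRing.maximalIdeal A)
    {P : MvPolynomial (Fin n) k} {N : ℕ} (hP : ∀ u : Fin n →₀ ℕ, u.degree < N → P.coeff u = 0) :
    MvPolynomial.aeval z P ∈ IsLocalRing.maximalIdeal A ^ N := by
  rw [MvPolynomial.aeval_def, MvPolynomial.eval₂_eq]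
  refine Ideal.sum_mem _ fun u hu => ?_
  have hN : N ≤ u.degree := by
    by_contra! h
    exact (MvPolynomial.mem_support_iff.1 hu) (hP u h)
  refine Ideal.mul_mem_left _ _ (Ideal.pow_le_pow_right hN ?_)
  rw [Finsupp.degree_apply, ← Finset.prod_pow_eq_pow_sum]
  exact Ideal.prod_mem_prod fun i _ => Ideal.pow_mem_pow (hz i) _

/-- Any polynomial that agrees with `F` in degrees less than `N` may serve as the truncation of `F`
in the definition of an expansion. -/
lemma hasExpansion_iff (hz : ∀ i, z i ∈ IsLocalRing.maximalIdeal A) {f : A}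
    {F : MvPowerSeries (Fin n) k} :
    HasExpansion z f F ↔ ∀ N : ℕ, ∃ P : MvPolynomial (Fin n) k,
      (∀ u : Fin n →₀ ℕ, u.degree < N → P.coeff u = MvPowerSeries.coeff u F) ∧
      f - MvPolynomial.aeval z P ∈ IsLocalRing.maximalIdeal A ^ N := by
  let T : ℕ → MvPolynomial (Fin n) k := fun N => ∑ d ∈ Finset.range N,
    ∑ u ∈ Finset.finsuppAntidiag Finset.univ d,
      MvPolynomial.monomial u (MvPowerSeries.coeff u F)
  have hT : ∀ N (u : Fin n →₀ ℕ), u.degree < N →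
      (T N).coeff u = MvPowerSeries.coeff u F := by
    intro N u hu
    simp only [T, MvPolynomial.coeff_sum, MvPolynomial.coeff_monomial]
    rw [Finset.sum_eq_single u.degree, Finset.sum_ite_eq' , if_pos]
    · simp [Finset.mem_finsuppAntidiag, Finsupp.degree_eq_sum]
    · intro d _ hd
      refine Finset.sum_eq_zero fun v hv => if_neg ?_
      rintro rfl
      simp [Finset.mem_finsuppAntidiag, ← Finsupp.degree_eq_sum] at hv
      exact hd hv.symm
    · intro h
      exact absurd (Finset.mem_range.2 hu) h
  have haT : ∀ N, MvPolynomial.aeval z (T N) = ∑ d ∈ Finset.range N,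
      ∑ u ∈ Finset.finsuppAntidiag Finset.univ d,
        algebraMap k A (MvPowerSeries.coeff u F) * ∏ i, z i ^ u i := by
    intro N
    simp [T, map_sum, MvPolynomial.aeval_monomial, Finsupp.prod_fintype]
  refine forall_congr' fun N => ⟨fun h => ⟨T N, hT N, (haT N).symm ▸ h⟩, ?_⟩
  rintro ⟨P, hP, hfP⟩
  have h := aeval_mem_maximalIdeal_pow hz (P := P - T N) (N := N) fun u hu => by
    rw [MvPolynomial.coeff_sub, hP u hu, hT N u hu, sub_self]
  rw [← haT]
  have := Ideal.add_mem _ hfP h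
  rwa [map_sub, sub_add_sub_cancel] at this

/-- Every polynomial in the `z_i` has the obvious expansion. -/
lemma hasExpansion_aeval (hz : ∀ i, z i ∈ IsLocalRing.maximalIdeal A)
    (P : MvPolynomial (Fin n) k) :
    HasExpansion z (MvPolynomial.aeval z P) (P : MvPowerSeries _ k) :=
  (hasExpansion_iff hz).2 fun N => ⟨P, fun u _ => (MvPolynomial.coeff_coe P u).symm, by simp⟩

lemma HasExpansion.sub (hz : ∀ i, z i ∈ IsLocalRing.maximalIdeal A) {f g : A}
    {F G : MvPowerSeries (Fin n) k} (hf : HasExpansion z f F) (hg : HasExpansion z g G) :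
    HasExpansion z (f - g) (F - G) := by
  rw [hasExpansion_iff hz] at *
  intro N
  obtain ⟨P, hP, hfP⟩ := hf N
  obtain ⟨Q, hQ, hgQ⟩ := hg N
  refine ⟨P - Q, fun u hu => ?_, ?_⟩
  · rw [MvPolynomial.coeff_sub, hP u hu, hQ u hu, map_sub]
  · have := Ideal.sub_mem _ hfP hgQ
    rw [map_sub]
    convert this using 1
    ring

lemma HasExpansion.mul (hz : ∀ i, z i ∈ IsLocalRing.maximalIdeal A) {f g : A}
    {F G : MvPowerSeries (Fin n) k} (hf : HasExpansion z f F) (hg : HasExpansion z g G) :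
    HasExpansion z (f * g) (F * G) := by
  classical
  rw [hasExpansion_iff hz] at *
  intro N
  obtain ⟨P, hP, hfP⟩ := hf N
  obtain ⟨Q, hQ, hgQ⟩ := hg N
  refine ⟨P * Q, fun u hu => ?_, ?_⟩
  · rw [MvPolynomial.coeff_mul, MvPowerSeries.coeff_mul]
    refine Finset.sum_congr rfl fun a ha => ?_
    rw [Finset.HasAntidiagonal.mem_antidiagonal] at ha
    have h := congrArg Finsupp.degree ha
    rw [map_add] at h
    rw [hP _ (by omega), hQ _ (by omega)]
  · have := Ideal.add_mem _ (Ideal.mul_mem_left _ g hfP)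
      (Ideal.mul_mem_left _ (MvPolynomial.aeval z P) hgQ)
    rw [map_mul]
    convert this using 1
    ring

/-- Existence of the homogeneous terms of an expansion: if the residue field of `A` is `k`, then
modulo the next power each power of the maximal ideal consists of forms in the `z_i`. -/
lemma exists_isHomogeneous_sub_mem (hspan : Ideal.span (Set.range z) = IsLocalRing.maximalIdeal A)
    (hres : ∀ a : A, ∃ c : k, a - algebraMap k A c ∈ IsLocalRing.maximalIdeal A) (N : ℕ) :
    ∀ f ∈ IsLocalRing.maximalIdeal A ^ N, ∃ G : MvPolynomial (Fin n) k,
      G.IsHomogeneous N ∧ f - MvPolynomial.aeval z G ∈ IsLocalRing.maximalIdeal A ^ (N + 1) := by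
  have hz : ∀ i, z i ∈ IsLocalRing.maximalIdeal A := fun i =>
    hspan ▸ Ideal.subset_span ⟨i, rfl⟩
  have hlin : ∀ a ∈ IsLocalRing.maximalIdeal A, ∃ G : MvPolynomial (Fin n) k,
      G.IsHomogeneous 1 ∧ a - MvPolynomial.aeval z G ∈ IsLocalRing.maximalIdeal A ^ 2 := by
    intro a ha
    rw [← hspan, Ideal.mem_span_range_iff_exists_fun] at ha
    obtain ⟨c, rfl⟩ := ha
    choose r hr using fun i => hres (c i)
    refine ⟨∑ i, MvPolynomial.C (r i) * MvPolynomial.X i,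
      MvPolynomial.IsHomogeneous.sum _ _ _ fun i _ => ?_, ?_⟩
    · simpa using (MvPolynomial.isHomogeneous_C (Fin n) (r i)).mul
        (MvPolynomial.isHomogeneous_X k i)
    · rw [map_sum, ← Finset.sum_sub_distrib]
      refine Ideal.sum_mem _ fun i _ => ?_
      have := Ideal.mul_mem_mul (hr i) (hz i)
      rw [← pow_two] at this
      convert this using 1
      simp [sub_mul]
  induction N with
  | zero =>
    intro f _
    obtain ⟨c, hc⟩ := hres f
    exact ⟨MvPolynomial.C c, MvPolynomial.isHomogeneous_C _ _, by simpa using hc⟩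
  | succ N ih =>
    intro f hf
    rw [pow_succ] at hf
    refine Submodule.mul_induction_on hf (fun a ha b hb => ?_) ?_
    · obtain ⟨G, hG, haG⟩ := ih a ha
      obtain ⟨H, hH, hbH⟩ := hlin b hb
      refine ⟨G * H, hG.mul hH, ?_⟩
      have hG' : MvPolynomial.aeval z G ∈ IsLocalRing.maximalIdeal A ^ N :=
        aeval_mem_maximalIdeal_pow hz fun u hu => hG.coeff_eq_zero hu.ne
      have h1 := Ideal.mul_mem_mul haG hb
      have h2 := Ideal.mul_mem_mul hG' hbH
      rw [← pow_succ] at h1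
      rw [← pow_add] at h2
      have := Ideal.add_mem _ h1 h2
      rw [map_mul]
      convert this using 1
      ring
    · rintro a b ⟨G, hG, haG⟩ ⟨H, hH, hbH⟩
      refine ⟨G + H, hG.add hH, ?_⟩
      have := Ideal.add_mem _ haG hbH
      rw [map_add]
      convert this using 1
      ring

/-- If the residue field of `A` is `k` and the `z_i` generate the maximal ideal, every element has
a power series expansion. -/
lemma exists_hasExpansion (hspan : Ideal.span (Set.range z) = IsLocalRing.maximalIdeal A)
    (hres : ∀ a : A, ∃ c : k, a - algebraMap k A c ∈ IsLocalRing.maximalIdeal A) (f : A) :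
    ∃ F : MvPowerSeries (Fin n) k, HasExpansion z f F := by
  have hz : ∀ i, z i ∈ IsLocalRing.maximalIdeal A := fun i =>
    hspan ▸ Ideal.subset_span ⟨i, rfl⟩
  choose G hG hfG using exists_isHomogeneous_sub_mem hspan hres
  let P : ∀ N : ℕ,
      {P : MvPolynomial (Fin n) k // f - MvPolynomial.aeval z P ∈ IsLocalRing.maximalIdeal A ^ N} :=
    fun N => Nat.rec ⟨0, by simp⟩ (fun N P => ⟨P.1 + G N _ P.2, by
      rw [map_add, ← sub_sub]; exact hfG N _ P.2⟩) N
  have hP : ∀ N, (P (N + 1)).1 = (P N).1 + G N _ (P N).2 := fun N => rfl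
  have hstab : ∀ (u : Fin n →₀ ℕ) (j : ℕ),
      (P (u.degree + 1 + j)).1.coeff u = (P (u.degree + 1)).1.coeff u := by
    intro u j
    induction j with
    | zero => rfl
    | succ j ih =>
      rw [← add_assoc, hP, MvPolynomial.coeff_add, ih, (hG _ _ _).coeff_eq_zero (by omega),
        add_zero]
  refine ⟨fun u => (P (u.degree + 1)).1.coeff u, (hasExpansion_iff hz).2 fun N =>
    ⟨(P N).1, fun u hu => ?_, (P N).2⟩⟩
  obtain ⟨j, rfl⟩ := Nat.exists_eq_add_of_le (Nat.succ_le_of_lt hu)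
  exact hstab u j

/-- Term by term differentiation of an expansion. -/
lemma HasExpansion.derivation (hz : ∀ i, z i ∈ IsLocalRing.maximalIdeal A) {f : A}
    {F : MvPowerSeries (Fin n) k} (hf : HasExpansion z f F) {i : Fin n} {D : Derivation k A A}
    (hD : ∀ j, D (z j) = if j = i then 1 else 0) :
    HasExpansion z (D f) (fun u => MvPowerSeries.coeff (u + Finsupp.single i 1) F * (u i + 1)) := by
  have hDpow : ∀ (N : ℕ) (a : A), a ∈ IsLocalRing.maximalIdeal A ^ (N + 1) →
      D a ∈ IsLocalRing.maximalIdeal A ^ N := by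
    intro N
    induction N with
    | zero => intro a _; simp
    | succ N ih =>
      intro a ha
      rw [pow_succ] at ha
      refine Submodule.mul_induction_on ha (fun a ha b hb => ?_) fun a b ha hb => ?_
      · rw [Derivation.leibniz, smul_eq_mul, smul_eq_mul]
        refine Ideal.add_mem _ (Ideal.mul_mem_right _ _ ha) ?_
        rw [mul_comm, pow_succ]
        exact Ideal.mul_mem_mul (ih a ha) hb
      · rw [map_add]
        exact Ideal.add_mem _ ha hb
  have hDP : ∀ P : MvPolynomial (Fin n) k,
      D (MvPolynomial.aeval z P) = MvPolynomial.aeval z (MvPolynomial.pderiv i P) := by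
    intro P
    induction P using MvPolynomial.induction_on with
    | C c => simp
    | add P Q hP hQ => simp [hP, hQ]
    | mul_X P j hP =>
      rw [map_mul, Derivation.leibniz, hP, MvPolynomial.aeval_X, hD, Derivation.leibniz,
        MvPolynomial.pderiv_X]
      simp [Pi.single_apply, apply_ite (MvPolynomial.aeval z), eq_comm]
  refine (hasExpansion_iff hz).2 fun N => ?_
  obtain ⟨P, hP, hfP⟩ := (hasExpansion_iff hz).1 hf (N + 1)
  refine ⟨MvPolynomial.pderiv i P, fun u hu => ?_, ?_⟩
  · rw [MvPolynomial.coeff_pderiv, hP _ (by rw [map_add, Finsupp.degree_single]; omega)]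
    rfl
  · have := hDpow N _ hfP
    rwa [map_sub, hDP] at this

/-- Uniqueness of the expansion of `0`. Applying the derivations `∂ / ∂ z_i` repeatedly moves any
coefficient, up to a nonzero integer factor, into degree zero, where it has to lie in the maximal
ideal. -/
lemma HasExpansion.eq_zero [CharZero k] (hz : ∀ i, z i ∈ IsLocalRing.maximalIdeal A)
    {D : Fin n → Derivation k A A} (hD : ∀ i j, D i (z j) = if j = i then 1 else 0)
    {F : MvPowerSeries (Fin n) k} (hF : HasExpansion z 0 F) : F = 0 := by
  suffices h : ∀ (d : ℕ) (F : MvPowerSeries (Fin n) k), HasExpansion z 0 F →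
      ∀ u : Fin n →₀ ℕ, u.degree = d → MvPowerSeries.coeff u F = 0 by
    ext u
    exact h _ F hF u rfl
  intro d
  induction d with
  | zero =>
    intro F hF u hu
    obtain rfl : u = 0 := by rwa [Finsupp.degree_eq_zero_iff] at hu
    obtain ⟨P, hP, hfP⟩ := (hasExpansion_iff hz).1 hF 1
    rw [← hP 0 (by simp)]
    by_contra hc
    have h1 := aeval_mem_maximalIdeal_pow hz (N := 1) (P := P - MvPolynomial.C (P.coeff 0))
      fun u hu => by
        obtain rfl : u = 0 := by
          rwa [Nat.lt_one_iff, Finsupp.degree_eq_zero_iff] at hu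
        simp
    have h2 := Ideal.add_mem _ hfP h1
    rw [map_sub, MvPolynomial.aeval_C, zero_sub, neg_add_eq_sub, sub_sub_cancel_left, neg_mem_iff,
      pow_one, IsLocalRing.mem_maximalIdeal] at h2
    exact h2 ((Ne.isUnit hc).map (algebraMap k A))
  | succ d ih =>
    intro F hF u hu
    obtain ⟨i, hi⟩ : ∃ i, u i ≠ 0 := by
      by_contra! h
      obtain rfl : u = 0 := Finsupp.ext h
      simp at hu
    have hu' : u - Finsupp.single i 1 + Finsupp.single i 1 = u :=
      tsub_add_cancel_of_le (Finsupp.single_le_iff.2 (Nat.one_le_iff_ne_zero.2 hi))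
    have hF' := hF.derivation hz (hD i)
    rw [map_zero] at hF'
    have h := ih _ hF' (u - Finsupp.single i 1) (by
      have := congrArg Finsupp.degree hu'
      rw [map_add, Finsupp.degree_single, hu] at this
      omega)
    change MvPowerSeries.coeff (u - Finsupp.single i 1 + Finsupp.single i 1) F *
      (((u - Finsupp.single i 1 : Fin n →₀ ℕ) i : ℕ) + 1 : k) = 0 at h
    rw [hu'] at h
    exact (mul_eq_zero.1 h).resolve_right (Nat.cast_add_one_ne_zero _)

end Expansion

/-! ### The valuation of a coordinate system -/

section Value

variable {k A : Type*} [Field k] [CommRing A] [IsLocalRing A] [Algebra k A] {n : ℕ}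

variable (k) in
/-- Local coordinates of a `k`-algebra with residue field `k`, in the form in which they are used
here: generators of the maximal ideal whose dual derivations exist. -/
structure IsCoordinateSystem (z : Fin n → A) : Prop where
  span_eq : Ideal.span (Set.range z) = IsLocalRing.maximalIdeal A
  exists_sub_mem : ∀ a : A, ∃ c : k, a - algebraMap k A c ∈ IsLocalRing.maximalIdeal A
  exists_derivation : ∀ i, ∃ D : Derivation k A A, ∀ j, D (z j) = if j = i then 1 else 0

/-- The exponent `u` is the least one, for the monomial order, that occurs in a power series
expansion of `f`. -/
def HasValue (k : Type*) {A : Type*} [Field k] [CommRing A] [IsLocalRing A] [Algebra k A] {n : ℕ}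
    (ord : MonomialOrder (Fin n)) (z : Fin n → A) (f : A) (u : Fin n →₀ ℕ) : Prop :=
  ∃ F : MvPowerSeries (Fin n) k, HasExpansion z f F ∧
    MvPowerSeries.coeff u F ≠ 0 ∧ ∀ v, MvPowerSeries.coeff v F ≠ 0 → u ≼[ord] v

variable {z : Fin n → A} {ord : MonomialOrder (Fin n)}

lemma IsCoordinateSystem.mem (h : IsCoordinateSystem k z) (i : Fin n) :
    z i ∈ IsLocalRing.maximalIdeal A :=
  h.span_eq ▸ Ideal.subset_span ⟨i, rfl⟩

lemma HasExpansion.unique [CharZero k] (h : IsCoordinateSystem k z) {f : A}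
    {F G : MvPowerSeries (Fin n) k} (hF : HasExpansion z f F) (hG : HasExpansion z f G) :
    F = G := by
  choose D hD using h.exists_derivation
  have := hF.sub h.mem hG
  rw [sub_self] at this
  exact sub_eq_zero.1 (this.eq_zero h.mem hD)

/-- By Krull's intersection theorem only `0` has expansion `0`, so nonzero elements have a value. -/
lemma exists_hasValue [IsNoetherianRing A] (h : IsCoordinateSystem k z)
    (ord : MonomialOrder (Fin n)) {f : A} (hf : f ≠ 0) : ∃ u, HasValue k ord z f u := by
  obtain ⟨F, hF⟩ := exists_hasExpansion h.span_eq h.exists_sub_mem f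
  obtain ⟨v, hv⟩ : ∃ v, MvPowerSeries.coeff v F ≠ 0 := by
    by_contra! h0
    refine hf ?_
    have := Ideal.iInf_pow_eq_bot_of_isLocalRing (IsLocalRing.maximalIdeal A) Ideal.IsPrime.ne_top'
    rw [← Ideal.mem_bot, ← this, Ideal.mem_iInf]
    intro N
    simpa [h0] using hF N
  obtain ⟨u, hu, hmin⟩ := (InvImage.wf ord.toSyn (wellFounded_lt (α := ord.syn))).has_min
    {v | MvPowerSeries.coeff v F ≠ 0} ⟨v, hv⟩
  exact ⟨u, F, hF, hu, fun v hv => not_lt.1 (hmin v hv)⟩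

lemma HasValue.unique [CharZero k] (h : IsCoordinateSystem k z) {f : A} {u v : Fin n →₀ ℕ}
    (hu : HasValue k ord z f u) (hv : HasValue k ord z f v) : u = v := by
  obtain ⟨F, hF, hFu, hFm⟩ := hu
  obtain ⟨G, hG, hGv, hGm⟩ := hv
  obtain rfl := hF.unique h hG
  exact ord.toSyn.injective (le_antisymm (hFm v hGv) (hGm u hFu))

lemma HasValue.ne_zero [CharZero k] (h : IsCoordinateSystem k z) {f : A} {u : Fin n →₀ ℕ}
    (hu : HasValue k ord z f u) : f ≠ 0 := by
  rintro rfl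
  obtain ⟨F, hF, hFu, -⟩ := hu
  have h0 : HasExpansion z (0 : A) (0 : MvPowerSeries (Fin n) k) := fun N => by simp
  obtain rfl := hF.unique h h0
  exact hFu (map_zero _)

lemma HasValue.mul (hz : ∀ i, z i ∈ IsLocalRing.maximalIdeal A) {f g : A} {u v : Fin n →₀ ℕ}
    (hu : HasValue k ord z f u) (hv : HasValue k ord z g v) :
    HasValue k ord z (f * g) (u + v) := by
  classical
  obtain ⟨F, hF, hFu, hFm⟩ := hu
  obtain ⟨G, hG, hGv, hGm⟩ := hv
  refine ⟨F * G, hF.mul hz hG, ?_, fun w hw => ?_⟩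
  · rw [MvPowerSeries.coeff_mul, Finset.sum_eq_single (u, v)]
    · exact mul_ne_zero hFu hGv
    · rintro ⟨a, b⟩ hab hne
      rw [Finset.HasAntidiagonal.mem_antidiagonal] at hab
      by_contra h
      have ha := hFm a (left_ne_zero_of_mul h)
      have hb := hGm b (right_ne_zero_of_mul h)
      have hsum : ord.toSyn a + ord.toSyn b = ord.toSyn u + ord.toSyn v := by
        rw [← map_add, ← map_add]
        exact congrArg _ hab
      have hau : ord.toSyn u = ord.toSyn a := by
        refine ha.eq_of_not_lt fun hlt => ?_
        exact (add_lt_add_of_lt_of_le hlt hb).ne' hsum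
      obtain rfl := ord.toSyn.injective hau
      obtain rfl := add_left_cancel hab
      exact hne rfl
    · intro h
      simp [Finset.HasAntidiagonal.mem_antidiagonal] at h
  · rw [MvPowerSeries.coeff_mul] at hw
    obtain ⟨⟨a, b⟩, hab, hne⟩ := Finset.exists_ne_zero_of_sum_ne_zero hw
    rw [Finset.HasAntidiagonal.mem_antidiagonal] at hab
    rw [← show a + b = w from hab, map_add, map_add]
    exact add_le_add (hFm a (left_ne_zero_of_mul hne)) (hGm b (right_ne_zero_of_mul hne))

lemma hasValue_algebraMap (hz : ∀ i, z i ∈ IsLocalRing.maximalIdeal A) {c : k} (hc : c ≠ 0) :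
    HasValue k ord z (algebraMap k A c) 0 := by
  have := hasExpansion_aeval hz (MvPolynomial.C c)
  rw [MvPolynomial.aeval_C] at this
  exact ⟨_, this, by simpa using hc, fun v _ => by simp⟩

lemma hasValue_coordinate (hz : ∀ i, z i ∈ IsLocalRing.maximalIdeal A) (i : Fin n) :
    HasValue k ord z (z i) (Finsupp.single i 1) := by
  classical
  have := hasExpansion_aeval hz (MvPolynomial.X i : MvPolynomial (Fin n) k)
  rw [MvPolynomial.aeval_X] at this
  refine ⟨_, this, by simp, fun v hv => ?_⟩
  rw [MvPolynomial.coeff_coe, MvPolynomial.coeff_X] at hv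
  rw [(ite_ne_right_iff.1 hv).1]

end Value

/-! ### Differentials and dimension -/

section Differentials

open KaehlerDifferential

/-- In characteristic zero the differentials of algebraically independent elements of a finitely
generated field extension are linearly independent, because the extension is formally smooth over
the polynomial ring that these elements generate. -/
lemma linearIndependent_D_of_algebraicIndependent {k K : Type*} [Field k] [CharZero k] [Field K]
    [Algebra k K] [Algebra.EssFiniteType k K] {ι : Type*} {x : ι → K}
    (hx : AlgebraicIndependent k x) : LinearIndependent K (fun i => D k K (x i)) := by
  let P := MvPolynomial ι k
  let F := FractionRing P
  let : Algebra P K := (MvPolynomial.aeval x).toAlgebra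
  have hinj : Function.Injective (algebraMap P K) := hx
  have : FaithfulSMul P K := (faithfulSMul_iff_algebraMap_injective P K).2 hinj
  have : IsScalarTower k P K := .of_algebraMap_eq' (MvPolynomial.aeval x).comp_algebraMap.symm
  let : Algebra F K := FractionRing.liftAlgebra P K
  have : IsScalarTower P F K := FractionRing.isScalarTower_liftAlgebra P K
  have : IsScalarTower k F K := IsScalarTower.to₁₃₄ k P F K
  have : Algebra.EssFiniteType F K := .of_comp k F K
  have : CharZero F := charZero_of_injective_algebraMap (algebraMap k F).injective
  have : Algebra.FormallySmooth P F := .of_isLocalization (nonZeroDivisors P)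
  have : Algebra.FormallySmooth P K := .comp P F K
  have hmap : Function.Injective (mapBaseChange k P K) := by
    rw [injective_iff_map_eq_zero]
    intro y hy
    obtain ⟨w, rfl⟩ := (Algebra.H1Cotangent.exact_δ_mapBaseChange k P K y).1 hy
    rw [Subsingleton.elim w 0, map_zero]
  have hb := ((mvPolynomialBasis k ι).baseChange K).linearIndependent.map'
    (mapBaseChange k P K) (LinearMap.ker_eq_bot.2 hmap)
  have hD : (fun i => D k K (x i)) =
      mapBaseChange k P K ∘ (mvPolynomialBasis k ι).baseChange K := by
    ext i
    simp [mvPolynomialBasis_apply, RingHom.algebraMap_toAlgebra, P]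
  rw [hD]
  exact hb

/-- The dimension of a finitely generated domain is at most the dimension of the space of
differentials of its field of fractions. -/
lemma ringKrullDim_le_finrank_kaehlerDifferential {k B K : Type*} [Field k] [CharZero k]
    [CommRing B] [IsDomain B] [Algebra k B] [Algebra.FiniteType k B] [Field K] [Algebra B K]
    [IsFractionRing B K] [Algebra k K] [IsScalarTower k B K] :
    ringKrullDim B ≤ Module.finrank K Ω[K⁄k] := by
  obtain ⟨s, g, hg, hint⟩ := exists_integral_inj_algHom_of_fg k B
  have hdim : ringKrullDim B ≤ s := by
    let := g.toRingHom.toAlgebra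
    have : Algebra.IsIntegral (MvPolynomial (Fin s) k) B := ⟨hint⟩
    have := Order.krullDim_le_of_strictMono
      (PrimeSpectrum.comap (algebraMap (MvPolynomial (Fin s) k) B))
      fun I J hIJ => Ideal.IsIntegral.comap_lt_comap hIJ
    refine this.trans (le_of_eq ?_)
    change ringKrullDim (MvPolynomial (Fin s) k) = s
    simp
  have : Algebra.EssFiniteType B K := .of_isLocalization K (nonZeroDivisors B)
  have : Algebra.EssFiniteType k K := .comp k B K
  let x : Fin s → K := fun i => algebraMap B K (g (MvPolynomial.X i))
  have hx : AlgebraicIndependent k x := by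
    have : MvPolynomial.aeval x = (IsScalarTower.toAlgHom k B K).comp g := by
      ext i; simp [x]
    rw [AlgebraicIndependent, this]
    exact (IsFractionRing.injective B K).comp hg
  have := (linearIndependent_D_of_algebraicIndependent hx).fintype_card_le_finrank
  rw [Fintype.card_fin] at this
  exact hdim.trans (by exact_mod_cast this)

/-- If the residue field is `k`, generators of the maximal ideal span the differentials, by
Nakayama's lemma. -/
lemma span_range_D_eq_top {k A : Type*} [Field k] [CommRing A] [IsLocalRing A] [Algebra k A]
    [Algebra.EssFiniteType k A] {n : ℕ} {z : Fin n → A}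
    (hspan : Ideal.span (Set.range z) = IsLocalRing.maximalIdeal A)
    (hres : ∀ a : A, ∃ c : k, a - algebraMap k A c ∈ IsLocalRing.maximalIdeal A) :
    Submodule.span A (Set.range fun i => D k A (z i)) = ⊤ := by
  refine top_le_iff.1 (Submodule.le_of_le_smul_of_le_jacobson_bot (Module.Finite.fg_top)
    (IsLocalRing.maximalIdeal_le_jacobson ⊥) ?_)
  rw [← span_range_derivation, Submodule.span_le]
  rintro _ ⟨a, rfl⟩
  obtain ⟨c, hc⟩ := hres a
  rw [← hspan, Ideal.mem_span_range_iff_exists_fun] at hc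
  obtain ⟨r, hr⟩ := hc
  have hD : D k A a = ∑ i, (r i • D k A (z i) + z i • D k A (r i)) := by
    have := congrArg (D k A) hr
    rw [map_sub, Derivation.map_algebraMap, sub_zero, map_sum] at this
    rw [← this]
    exact Finset.sum_congr rfl fun i _ => Derivation.leibniz _ _ _
  rw [hD, Finset.sum_add_distrib]
  refine Submodule.add_mem_sup (Submodule.sum_mem _ fun i _ => ?_)
    (Submodule.sum_mem _ fun i _ => ?_)
  · exact Submodule.smul_mem _ _ (Submodule.subset_span ⟨i, rfl⟩)
  · rw [span_range_derivation]
    exact Submodule.smul_mem_smul (hspan ▸ Ideal.subset_span ⟨i, rfl⟩) trivial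

/-- Generators of the maximal ideal, as many as the dimension of the space of differentials of the
field of fractions, are local coordinates: their differentials form a basis. -/
lemma isCoordinateSystem_of_le_finrank {k A K : Type*} [Field k] [CommRing A] [IsDomain A]
    [IsLocalRing A] [Algebra k A] [Algebra.EssFiniteType k A] [Field K] [Algebra A K]
    [IsFractionRing A K] [Algebra k K] [IsScalarTower k A K] {n : ℕ} {z : Fin n → A}
    (hspan : Ideal.span (Set.range z) = IsLocalRing.maximalIdeal A)
    (hres : ∀ a : A, ∃ c : k, a - algebraMap k A c ∈ IsLocalRing.maximalIdeal A)
    (hn : n ≤ Module.finrank K Ω[K⁄k]) : IsCoordinateSystem k z := by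
  have htop := span_range_D_eq_top hspan hres
  have htopK : ⊤ ≤ Submodule.span K
      (Set.range fun i => KaehlerDifferential.map k k A K (D k A (z i))) := by
    rw [← span_range_map_derivation_of_isLocalization k A K (nonZeroDivisors A), Submodule.span_le]
    rintro _ ⟨a, rfl⟩
    have ha : D k A a ∈ Submodule.span A (Set.range fun i => D k A (z i)) := htop ▸ trivial
    have := Submodule.mem_map_of_mem (f := KaehlerDifferential.map k k A K) ha
    rw [Submodule.map_span, ← Set.range_comp] at this
    exact Submodule.span_le_restrictScalars A K _ this
  have hle := finrank_range_le_card (R := K)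
    (fun i => KaehlerDifferential.map k k A K (D k A (z i)))
  rw [Set.finrank, top_le_iff.1 htopK, finrank_top] at hle
  have hK := linearIndependent_of_top_le_span_of_card_eq_finrank htopK
    (le_antisymm (by simpa using hn) hle)
  have hA : LinearIndependent A (fun i => D k A (z i)) :=
    LinearIndependent.of_comp (KaehlerDifferential.map k k A K)
      (hK.restrict_scalars (by
        simpa [Algebra.smul_def] using IsFractionRing.injective A K))
  let b := Module.Basis.mk hA htop.ge
  refine ⟨hspan, hres, fun i => ⟨(b.coord i).compDer (D k A), fun j => ?_⟩⟩
  have : D k A (z j) = b j := (Module.Basis.mk_apply hA htop.ge j).symm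
  change b.coord i (D k A (z j)) = _
  rw [this]
  simp [Finsupp.single_apply]

end Differentials

/-! ### Graded families of subspaces and their semigroups of values -/

section Semigroup

variable {k A : Type*} [Field k] [CommRing A] [IsDomain A] [Algebra k A]

/-- The subfield of all quotients `f / g` of elements of the same degree of a graded family of
subspaces of `A`. -/
def quotientField (K : Type*) [Field K] [Algebra A K] [IsFractionRing A K] [Algebra k K]
    [IsScalarTower k A K] (V : ℕ → Submodule k A) (hone : 1 ∈ V 0)
    (hmul : ∀ {i j : ℕ} {f g : A}, f ∈ V i → g ∈ V j → f * g ∈ V (i + j)) :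
    IntermediateField k K where
  carrier := {x | ∃ m, ∃ f ∈ V m, ∃ g ∈ V m, g ≠ 0 ∧ algebraMap A K f = x * algebraMap A K g}
  mul_mem' := by
    rintro x y ⟨m, f, hf, g, hg, hg0, h⟩ ⟨m', f', hf', g', hg', hg0', h'⟩
    refine ⟨m + m', f * f', hmul hf hf', g * g', hmul hg hg', mul_ne_zero hg0 hg0', ?_⟩
    rw [map_mul, map_mul, h, h']
    ring
  add_mem' := by
    rintro x y ⟨m, f, hf, g, hg, hg0, h⟩ ⟨m', f', hf', g', hg', hg0', h'⟩
    refine ⟨m + m', f * g' + g * f', (V _).add_mem (hmul hf hg') (hmul hg hf'), g * g',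
      hmul hg hg', mul_ne_zero hg0 hg0', ?_⟩
    rw [map_add, map_mul, map_mul, map_mul, h, h']
    ring
  algebraMap_mem' c := ⟨0, c • 1, (V 0).smul_mem c hone, 1, hone, one_ne_zero, by
    rw [Algebra.smul_def, mul_one, map_one, mul_one, ← IsScalarTower.algebraMap_apply]⟩
  inv_mem' := by
    rintro x ⟨m, f, hf, g, hg, hg0, h⟩
    rcases eq_or_ne x 0 with rfl | hx
    · exact ⟨m, f, hf, g, hg, hg0, by simpa using h⟩
    · refine ⟨m, g, hg, f, hf, ?_, by rw [h, inv_mul_cancel_left₀ hx]⟩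
      rintro rfl
      rw [map_zero, zero_eq_mul] at h
      exact h.elim hx fun h => hg0 ((map_eq_zero_iff _ (IsFractionRing.injective A K)).1 h)

/-- If the quotients of elements of some `V m` generate the field of fractions `K`, then every
element of `K` is a quotient of two elements of the same degree. -/
lemma exists_quotient_eq_of_adjoin_eq_top {K : Type*} [Field K] [Algebra A K] [IsFractionRing A K]
    [Algebra k K] [IsScalarTower k A K] {V : ℕ → Submodule k A} (hone : 1 ∈ V 0)
    (hmul : ∀ {i j : ℕ} {f g : A}, f ∈ V i → g ∈ V j → f * g ∈ V (i + j)) {m : ℕ}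
    (htop : IntermediateField.adjoin k {x : K | ∃ f ∈ V m, ∃ g ∈ V m, g ≠ 0 ∧
      algebraMap A K f = x * algebraMap A K g} = ⊤) (x : K) :
    ∃ d, ∃ f ∈ V d, ∃ g ∈ V d, g ≠ 0 ∧ algebraMap A K f = x * algebraMap A K g := by
  have hle : IntermediateField.adjoin k {x : K | ∃ f ∈ V m, ∃ g ∈ V m, g ≠ 0 ∧
      algebraMap A K f = x * algebraMap A K g} ≤ quotientField K V hone hmul :=
    IntermediateField.adjoin_le_iff.2 fun y hy => ⟨m, hy⟩
  rw [htop] at hle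
  exact hle (IntermediateField.mem_top (x := x))

/-- The unit vectors and one element of degree one generate `ℤ × ℤ^n`. -/
lemma addSubgroup_eq_top {n : ℕ} {G : AddSubgroup (ℤ × (Fin n → ℤ))}
    (hunit : ∀ i, ((0 : ℤ), (Pi.single i 1 : Fin n → ℤ)) ∈ G) {w : Fin n → ℤ}
    (hw : ((1 : ℤ), w) ∈ G) : G = ⊤ := by
  have hzero : ∀ v : Fin n → ℤ, ((0 : ℤ), v) ∈ G := by
    intro v
    have : ((0 : ℤ), v) = ∑ i, v i • ((0 : ℤ), (Pi.single i 1 : Fin n → ℤ)) := by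
      ext j
      · simp [Prod.fst_sum]
      · simp [Prod.snd_sum, Finset.sum_apply, Pi.single_apply]
    rw [this]
    exact sum_mem fun i _ => zsmul_mem (hunit i) _
  refine eq_top_iff.2 fun ⟨a, v⟩ _ => ?_
  have : ((a : ℤ), v) = a • ((1 : ℤ), w) + ((0 : ℤ), v - a • w) := by
    ext <;> simp
  rw [this]
  exact add_mem (zsmul_mem hw _) (hzero _)

/-- The values of a graded family of subspaces form a birational semigroup if the quotients of
elements of the same degree generate the field of fractions. -/
theorem isBirationalSemigroup_values [CharZero k] [IsLocalRing A] [IsNoetherianRing A] {n : ℕ}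
    {z : Fin n → A} (h : IsCoordinateSystem k z) (ord : MonomialOrder (Fin n)) {K : Type*}
    [Field K] [Algebra A K] [IsFractionRing A K] [Algebra k K] [IsScalarTower k A K]
    {V : ℕ → Submodule k A} (hzero : V 0 = Submodule.span k {1})
    (hmul : ∀ {i j : ℕ} {f g : A}, f ∈ V i → g ∈ V j → f * g ∈ V (i + j))
    (htop : ∀ᶠ m in atTop, IntermediateField.adjoin k {x : K | ∃ f ∈ V m, ∃ g ∈ V m, g ≠ 0 ∧
      algebraMap A K f = x * algebraMap A K g} = ⊤)
    (hpt : n = 0 → ∀ᶠ m in atTop, V m ≠ ⊥) :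
    IsBirationalSemigroup {a : ℕ × (Fin n →₀ ℕ) | ∃ f ∈ V a.1, HasValue k ord z f a.2} := by
  have hone : (1 : A) ∈ V 0 := hzero ▸ Submodule.mem_span_singleton_self 1
  have hinj := IsFractionRing.injective A K
  have hne : ∀ᶠ m in atTop, V m ≠ ⊥ := by
    rcases Nat.eq_zero_or_pos n with hn | hn
    · exact hpt hn
    · filter_upwards [htop] with m hm hbot
      -- If `V m = 0`, then `K = k` and the first coordinate is a constant.
      rw [hbot] at hm
      have hempty : {x : K | ∃ f ∈ (⊥ : Submodule k A), ∃ g ∈ (⊥ : Submodule k A), g ≠ 0 ∧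
          algebraMap A K f = x * algebraMap A K g} = ∅ := by
        ext x
        simp
      rw [hempty, IntermediateField.adjoin_empty] at hm
      obtain ⟨c, hc⟩ := IntermediateField.mem_bot.1
        (hm ▸ IntermediateField.mem_top (x := algebraMap A K (z ⟨0, hn⟩)))
      rw [IsScalarTower.algebraMap_apply k A K] at hc
      have hzc := hinj hc
      have hval := hasValue_coordinate (k := k) (ord := ord) h.mem ⟨0, hn⟩
      have hc0 : c ≠ 0 := by
        rintro rfl
        rw [map_zero] at hzc
        exact hval.ne_zero h hzc.symm
      rw [← hzc] at hval
      have := hval.unique h (hasValue_algebraMap h.mem hc0)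
      simp at this
  refine ⟨?_, ?_, ?_⟩
  · rintro ⟨i, u⟩ ⟨f, hf, hu⟩ ⟨j, v⟩ ⟨g, hg, hv⟩
    exact ⟨f * g, hmul hf hg, hu.mul h.mem hv⟩
  · ext u
    refine ⟨?_, ?_⟩
    · rintro ⟨f, hf, hu⟩
      obtain ⟨c, rfl⟩ := Submodule.mem_span_singleton.1 (hzero ▸ hf)
      rw [Algebra.smul_def, mul_one] at hu
      have hc : c ≠ 0 := by
        rintro rfl
        exact hu.ne_zero h (map_zero _)
      exact hu.unique h (hasValue_algebraMap h.mem hc)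
    · rintro rfl
      refine ⟨1, hone, ?_⟩
      rw [← map_one (algebraMap k A)]
      exact hasValue_algebraMap h.mem one_ne_zero
  · have hsub : ∀ {i j : ℕ} {f g : A} {u v : Fin n →₀ ℕ}, f ∈ V i → HasValue k ord z f u →
        g ∈ V j → HasValue k ord z g v → toIntProd (i, u) - toIntProd (j, v) ∈
          AddSubgroup.closure (toIntProd ''
            {a : ℕ × (Fin n →₀ ℕ) | ∃ f ∈ V a.1, HasValue k ord z f a.2}) :=
      fun {i j f g u v} hf hu hg hv =>
        sub_mem (AddSubgroup.subset_closure ⟨(i, u), ⟨f, hf, hu⟩, rfl⟩)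
          (AddSubgroup.subset_closure ⟨(j, v), ⟨g, hg, hv⟩, rfl⟩)
    obtain ⟨N, hN⟩ := eventually_atTop.1 hne
    obtain ⟨g, hg, hg0⟩ := (V N).ne_bot_iff.1 (hN N le_rfl)
    obtain ⟨f, hf, hf0⟩ := (V (N + 1)).ne_bot_iff.1 (hN (N + 1) N.le_succ)
    obtain ⟨v, hv⟩ := exists_hasValue h ord hg0
    obtain ⟨u, hu⟩ := exists_hasValue h ord hf0
    refine addSubgroup_eq_top (fun i => ?_) (w := fun i => (u i : ℤ) - v i) ?_
    · obtain ⟨m, hm⟩ := htop.exists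
      obtain ⟨d, f, hf, g, hg, hg0, hfg⟩ :=
        exists_quotient_eq_of_adjoin_eq_top hone hmul hm (algebraMap A K (z i))
      -- Now `z i * g = f` with `f` and `g` of degree `d`, so their values differ by `e_i`.
      rw [← map_mul] at hfg
      obtain rfl := hinj hfg
      obtain ⟨v, hv⟩ := exists_hasValue h ord hg0
      have hzi := hasValue_coordinate (k := k) (ord := ord) h.mem i
      convert hsub hf (hzi.mul h.mem hv) hg hv using 1
      ext j
      · simp [toIntProd]
      · simp [toIntProd, Pi.single_apply, Finsupp.single_apply, eq_comm]
    · convert hsub hf hu hg hv using 1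
      ext j <;> simp [toIntProd]

end Semigroup

/-! ### The local ring of a complex variety at a closed point -/

section Variety

/-- An affine open neighbourhood of a point of the smallest member of a chain of irreducible closed
subsets meets all of them, so it contains a chain of the same length. -/
lemma exists_isAffineOpen_le_ringKrullDim (X : Scheme.{0}) {n : ℕ}
    (hn : (n : WithBot ℕ∞) ≤ topologicalKrullDim X) :
    ∃ U : X.Opens, IsAffineOpen U ∧ Nonempty U ∧ (n : WithBot ℕ∞) ≤ ringKrullDim Γ(X, U) := by
  obtain ⟨l, rfl⟩ := Order.le_krullDim_iff.1 hn
  obtain ⟨x, hx⟩ := l.head.isIrreducible'.nonempty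
  obtain ⟨U, hU, hxU, -⟩ := exists_isAffineOpen_mem_and_subset (U := ⊤) (x := x) trivial
  refine ⟨U, hU, ⟨⟨x, hxU⟩⟩, ?_⟩
  have hopen := hU.fromSpec.isOpenEmbedding
  have hne : (hU.fromSpec ⁻¹' (l.head : Set X)).Nonempty := by
    obtain ⟨y, rfl⟩ : x ∈ Set.range hU.fromSpec := by rw [hU.range_fromSpec]; exact hxU
    exact ⟨y, hx⟩
  let T := (TopologicalSpace.IrreducibleCloseds.orderIsoOfIsOpenEmbedding _ hopen).symm
    ⟨l.head, hne⟩
  have hT : TopologicalSpace.IrreducibleCloseds.map hU.fromSpec hopen.continuous T = l.head :=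
    congrArg Subtype.val ((TopologicalSpace.IrreducibleCloseds.orderIsoOfIsOpenEmbedding _
      hopen).apply_symm_apply ⟨l.head, hne⟩)
  rw [← PrimeSpectrum.topologicalKrullDim_eq_ringKrullDim]
  refine le_trans ?_ (Order.coheight_le_krullDim T)
  rw [← hopen.coheight_map T, hT]
  exact_mod_cast Order.length_le_coheight_head

variable (X : Scheme.{0}) [X.Over (Spec (.of ℂ))]

/-- The sections over an open subset of a scheme over `ℂ` form a `ℂ`-algebra, with the structure map
that induces `stalkAlgebra` on germs. It is an instance in this section only. -/
@[reducible]
noncomputable def sectionsAlgebra (U : X.Opens) : Algebra ℂ Γ(X, U) :=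
  ((X.presheaf.map (homOfLE le_top).op).hom.comp
    ((X ↘ Spec (.of ℂ)).appTop.hom.comp (Scheme.ΓSpecIso (.of ℂ)).inv.hom)).toAlgebra

attribute [local instance] sectionsAlgebra

lemma germ_algebraMap (U : X.Opens) (x : X) (hx : x ∈ U) (c : ℂ) :
    X.presheaf.germ U x hx (algebraMap ℂ Γ(X, U) c) = algebraMap ℂ (X.presheaf.stalk x) c :=
  TopCat.Presheaf.germ_res_apply X.presheaf (homOfLE le_top) x hx _

instance isScalarTower_sections_stalk (U : X.Opens) (x : U) :
    IsScalarTower ℂ Γ(X, U) (X.presheaf.stalk (x : X)) :=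
  .of_algebraMap_eq fun c => (germ_algebraMap X U x x.2 c).symm

instance isScalarTower_sections_functionField [IrreducibleSpace X] (U : X.Opens) [Nonempty U] :
    IsScalarTower ℂ Γ(X, U) X.functionField :=
  .of_algebraMap_eq fun c => (germ_algebraMap X U _ _ c).symm

instance isScalarTower_stalk_functionField [IrreducibleSpace X] (x : X) :
    IsScalarTower ℂ (X.presheaf.stalk x) X.functionField :=
  have : Nonempty (⊤ : X.Opens) := ⟨⟨x, trivial⟩⟩
  .of_algebraMap_eq fun c => by
    rw [← germ_algebraMap X ⊤ x (TopologicalSpace.Opens.mem_top x),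
      Scheme.algebraMap_germ_eq_germToFunctionField, germ_algebraMap]

variable [LocallyOfFiniteType (X ↘ Spec (.of ℂ))]

lemma finiteType_sections {U : X.Opens} (hU : IsAffineOpen U) : Algebra.FiniteType ℂ Γ(X, U) := by
  rw [← RingHom.finiteType_algebraMap]
  have h1 := (X ↘ Spec (.of ℂ)).finiteType_appLE (isAffineOpen_top _) hU le_top
  have h2 : (Scheme.ΓSpecIso (.of ℂ)).inv.hom.FiniteType :=
    .of_surjective _ (ConcreteCategory.bijective_of_isIso (Scheme.ΓSpecIso (.of ℂ)).inv).2
  exact h1.comp h2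

instance essFiniteType_stalk (x : X) : Algebra.EssFiniteType ℂ (X.presheaf.stalk x) := by
  obtain ⟨U, hU, hxU, -⟩ := exists_isAffineOpen_mem_and_subset (U := ⊤) (x := x) trivial
  have := finiteType_sections X hU
  obtain ⟨x', rfl⟩ : ∃ x' : U, (x' : X) = x := ⟨⟨x, hxU⟩, rfl⟩
  have := hU.isLocalization_stalk x'
  have : Algebra.EssFiniteType Γ(X, U) (X.presheaf.stalk (x' : X)) :=
    .of_isLocalization _ (hU.primeIdealOf x').asIdeal.primeCompl
  exact .comp ℂ Γ(X, U) (X.presheaf.stalk (x' : X))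

instance isNoetherianRing_stalk (x : X) : IsNoetherianRing (X.presheaf.stalk x) := by
  have := LocallyOfFiniteType.isLocallyNoetherian (X ↘ Spec (.of ℂ))
  infer_instance

/-- The residue field of a closed point is `ℂ`. -/
lemma exists_sub_algebraMap_mem_maximalIdeal {p : X} (hp : IsClosed {p}) (a : X.presheaf.stalk p) :
    ∃ c : ℂ, a - algebraMap ℂ (X.presheaf.stalk p) c ∈
      IsLocalRing.maximalIdeal (X.presheaf.stalk p) := by
  have h : CommRingCat.ofHom (algebraMap ℂ (X.presheaf.stalk p)) ≫ X.residue p =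
      (residueFieldIsoBase (X ↘ Spec (.of ℂ)) p hp).inv := by
    rw [← Spec.map_injective.eq_iff, SpecMap_residueFieldIsoBase_inv]
    apply ext_of_isAffine
    have hstalk : (X.fromSpecStalk p).appTop =
        X.presheaf.germ ⊤ p (TopologicalSpace.Opens.mem_top p) ≫
          (Scheme.ΓSpecIso (X.presheaf.stalk p)).inv := by
      rw [Scheme.fromSpecStalk_appTop, Subsingleton.elim (homOfLE _) (𝟙 _), op_id,
        CategoryTheory.Functor.map_id, Category.comp_id]
    rw [← cancel_epi (Scheme.ΓSpecIso (.of ℂ)).inv, ← Scheme.ΓSpecIso_inv_naturality,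
      Scheme.fromSpecResidueField, Scheme.Hom.comp_appTop, Scheme.Hom.comp_appTop,
      hstalk]
    simp only [Category.assoc]
    rw [← Scheme.ΓSpecIso_inv_naturality]
    simp only [← Category.assoc]
    congr 2
  obtain ⟨c, hc⟩ := (ConcreteCategory.bijective_of_isIso
    (residueFieldIsoBase (X ↘ Spec (.of ℂ)) p hp).inv).2 (X.residue p a)
  rw [← h] at hc
  refine ⟨c, ?_⟩
  rw [← IsLocalRing.residue_eq_zero_iff, map_sub, sub_eq_zero]
  exact hc.symm

/-- Generators of the maximal ideal at a closed point, as many as the dimension, are local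
coordinates. -/
lemma IsLocalCoordinates.isCoordinateSystem [IsIntegral X] {n : ℕ} {p : X} (hp : IsClosed {p})
    {z : Fin n → X.presheaf.stalk p} (hz : IsLocalCoordinates p z) : IsCoordinateSystem ℂ z := by
  obtain ⟨U, hU, hne, hdim⟩ := exists_isAffineOpen_le_ringKrullDim X hz.1.ge
  have := finiteType_sections X hU
  have := functionField_isFractionRing_of_isAffineOpen X U hU
  have hn : n ≤ Module.finrank X.functionField Ω[X.functionField⁄ℂ] := by
    exact_mod_cast hdim.trans (ringKrullDim_le_finrank_kaehlerDifferential (k := ℂ))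
  exact isCoordinateSystem_of_le_finrank (K := X.functionField) hz.2
    (exists_sub_algebraMap_mem_maximalIdeal X hp) hn

end Variety

/-! ### Sections of tensor powers of a line bundle -/

section Generator

variable {X : Scheme.{0}} {L : X.Modules}

/-- A section `e` of `L` over `U` is a generator if every section over a smaller open subset is a
unique multiple of `e`. -/
def IsGenerator {U : X.Opens} (e : Γ(L, U)) : Prop :=
  ∀ (V : X.Opens) (hV : V ≤ U),
    Function.Bijective fun h : Γ(X, V) => h • L.presheaf.map (homOfLE hV).op e

lemma IsLineBundle.exists_generator (hL : IsLineBundle L) (x : X) :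
    ∃ U : X.Opens, x ∈ U ∧ ∃ e : Γ(L, U), IsGenerator e := by
  obtain ⟨U, hxU, ⟨α⟩⟩ := hL x
  let N : U.toScheme.Modules := SheafOfModules.unit U.toScheme.ringCatSheaf
  let α' : L.restrict U.ι ≅ N := α
  let β : N ⟶ L.restrict U.ι := α'.inv
  have : IsIso β := inferInstanceAs (IsIso α'.inv)
  let one : ∀ V : U.toScheme.Opens, Γ(N, V) := fun V => (1 : Γ(U.toScheme, V))
  have hone : ∀ V : U.toScheme.Opens, N.presheaf.map (homOfLE le_top).op (one ⊤) = one V :=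
    fun V => map_one (U.toScheme.presheaf.map (homOfLE le_top).op).hom
  -- The generator is the section corresponding to `1`.
  refine ⟨U.ι ''ᵁ ⊤, ⟨⟨x, hxU⟩, trivial, rfl⟩, β.app ⊤ (one ⊤), fun V hV => ?_⟩
  obtain ⟨V, rfl⟩ : ∃ V' : U.toScheme.Opens, V = U.ι ''ᵁ V' := by
    refine ⟨U.ι ⁻¹ᵁ V, ?_⟩
    rw [Scheme.Hom.image_preimage_eq_opensRange_inf, Scheme.Opens.opensRange_ι, eq_comm,
      inf_eq_right]
    exact hV.trans (by simp)
  have hβ : Function.Bijective (β.app V) := ConcreteCategory.bijective_of_isIso (β.app V)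
  have happ : Function.Bijective (U.ι.appIso V).hom :=
    ConcreteCategory.bijective_of_isIso (U.ι.appIso V).hom
  have hnat : L.presheaf.map (homOfLE hV).op (β.app ⊤ (one ⊤)) = β.app V (one V) := by
    rw [← hone V]
    exact (ConcreteCategory.congr_hom (β.mapPresheaf.naturality (homOfLE le_top).op) (one ⊤)).symm
  have key : ∀ h : Γ(X, U.ι ''ᵁ V), h • L.presheaf.map (homOfLE hV).op (β.app ⊤ (one ⊤)) =
      β.app V ((U.ι.appIso V).hom h : Γ(U.toScheme, V)) := by
    intro h
    have hsmul : ((U.ι.appIso V).hom h : Γ(U.toScheme, V)) • one V = (U.ι.appIso V).hom h :=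
      mul_one ((U.ι.appIso V).hom h : Γ(U.toScheme, V))
    have hinv : (U.ι.appIso V).inv ((U.ι.appIso V).hom h) = h :=
      ConcreteCategory.congr_hom (U.ι.appIso V).hom_inv_id h
    let b : Γ(L, U.ι ''ᵁ V) := β.app V (one V)
    have hres : ((U.ι.appIso V).hom h : Γ(U.toScheme, V)) • β.app V (one V) =
        (U.ι.appIso V).inv ((U.ι.appIso V).hom h) • b := rfl
    rw [hinv] at hres
    rw [hnat, ← hsmul, β.app_smul]
    exact hres.symm
  simp_rw [key]
  exact hβ.comp happ

/-- The germ of a section of a sheaf of modules, as an element of the stalk. -/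
noncomputable def secGerm (L : X.Modules) {U : X.Opens} (t : Γ(L, U)) (y : X) (hy : y ∈ U) :
    Stalk L y :=
  TopCat.Presheaf.germ L.presheaf U y hy t

lemma secGerm_smul {U : X.Opens} (h : Γ(X, U)) (t : Γ(L, U)) (y : X) (hy : y ∈ U) :
    secGerm L (h • t) y hy = X.presheaf.germ U y hy h • secGerm L t y hy :=
  PresheafOfModules.germ_smul (R := X.presheaf) L.val y U hy h t

lemma secGerm_res {U V : X.Opens} (hV : V ≤ U) (t : Γ(L, U)) (y : X) (hy : y ∈ V) :
    secGerm L (L.presheaf.map (homOfLE hV).op t) y hy = secGerm L t y (hV hy) :=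
  TopCat.Presheaf.germ_res_apply L.presheaf (homOfLE hV) y hy t

/-- The germ of a generator is a basis of the stalk. -/
lemma IsGenerator.bijective_toSpanSingleton {U : X.Opens} {e : Γ(L, U)} (he : IsGenerator e)
    (y : X) (hy : y ∈ U) : Function.Bijective
      (LinearMap.toSpanSingleton (X.presheaf.stalk y) (Stalk L y) (secGerm L e y hy)) := by
  constructor
  · intro a a' haa
    obtain ⟨V, hyV, h, rfl⟩ := X.presheaf.exists_germ_eq a
    obtain ⟨V', hyV', h', rfl⟩ := X.presheaf.exists_germ_eq a'
    have hU : V ⊓ V' ⊓ U ≤ U := inf_le_right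
    have hy₀ : y ∈ V ⊓ V' ⊓ U := ⟨⟨hyV, hyV'⟩, hy⟩
    simp only [LinearMap.toSpanSingleton_apply] at haa
    rw [← X.presheaf.germ_res_apply (homOfLE (inf_le_left.trans inf_le_left)) y hy₀ h,
      ← X.presheaf.germ_res_apply (homOfLE (inf_le_left.trans inf_le_right)) y hy₀ h'] at haa ⊢
    rw [← secGerm_res hU e y hy₀, ← secGerm_smul, ← secGerm_smul] at haa
    obtain ⟨W, hyW, i, j, hW⟩ := TopCat.Presheaf.germ_eq L.presheaf y hy₀ hy₀ _ _ haa
    obtain rfl := Subsingleton.elim i j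
    rw [Scheme.Modules.map_smul, Scheme.Modules.map_smul] at hW
    have hres : L.presheaf.map i.op (L.presheaf.map (homOfLE hU).op e) =
        L.presheaf.map (homOfLE ((leOfHom i).trans hU)).op e := by
      rw [← ConcreteCategory.comp_apply, ← Functor.map_comp]
      rfl
    rw [hres] at hW
    have := (he W _).1 hW
    rw [← X.presheaf.germ_res_apply i y hyW, this, X.presheaf.germ_res_apply]
  · intro m
    obtain ⟨V, hyV, t, rfl⟩ := TopCat.Presheaf.exists_germ_eq L.presheaf m
    obtain ⟨h, hh⟩ := (he (V ⊓ U) inf_le_right).2 (L.presheaf.map (homOfLE inf_le_left).op t)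
    have hy₀ : y ∈ V ⊓ U := ⟨hyV, hy⟩
    refine ⟨X.presheaf.germ (V ⊓ U) y hy₀ h, ?_⟩
    change _ = secGerm L t y hyV
    rw [LinearMap.toSpanSingleton_apply, ← secGerm_res inf_le_right e y hy₀, ← secGerm_smul,
      ← secGerm_res inf_le_left t y hy₀]
    exact congrArg (fun m => secGerm L m y hy₀) hh

/-- The trivialization of the stalks of `L` given by a generator. -/
noncomputable def IsGenerator.stalkEquiv {U : X.Opens} {e : Γ(L, U)} (he : IsGenerator e)
    (y : X) (hy : y ∈ U) : Stalk L y ≃ₗ[X.presheaf.stalk y] X.presheaf.stalk y :=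
  (LinearEquiv.ofBijective _ (he.bijective_toSpanSingleton y hy)).symm

/-- In the trivialization given by a generator, a section of `L` is locally a function. -/
lemma IsGenerator.exists_stalkEquiv_eq_germ {U V : X.Opens} {e : Γ(L, U)} (he : IsGenerator e)
    (hV : V ≤ U) (t : Γ(L, V)) : ∃ h : Γ(X, V), ∀ (y : X) (hy : y ∈ V),
      he.stalkEquiv y (hV hy) (secGerm L t y hy) = X.presheaf.germ V y hy h := by
  obtain ⟨h, rfl⟩ := (he V hV).2 t
  refine ⟨h, fun y hy => ?_⟩
  rw [IsGenerator.stalkEquiv, LinearEquiv.symm_apply_eq, LinearEquiv.ofBijective_apply,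
    LinearMap.toSpanSingleton_apply, secGerm_smul, secGerm_res]

end Generator

section PowTrivialization

variable {X : Scheme.{0}} {L : X.Modules} {p : X}
  (φ : Stalk L p ≃ₗ[X.presheaf.stalk p] X.presheaf.stalk p)

lemma powTrivialization_tprod {k : ℕ} (m : Fin k → Stalk L p) :
    powTrivialization φ k (PiTensorProduct.tprod _ m) = ∏ i, φ (m i) := by
  simp [powTrivialization]

lemma powTrivialization_mulEquiv {j k : ℕ} (s : PowStalk L j p) (t : PowStalk L k p) :
    powTrivialization φ (j + k) (TensorPower.mulEquiv (s ⊗ₜ[X.presheaf.stalk p] t)) =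
      powTrivialization φ j s * powTrivialization φ k t := by
  rw [← TensorPower.gMul_def]
  induction s using PiTensorProduct.induction_on with
  | smul_tprod a m =>
    induction t using PiTensorProduct.induction_on with
    | smul_tprod b m' =>
      have : ∀ (a b : X.presheaf.stalk p) (s : PowStalk L j p) (t : PowStalk L k p),
          GradedMonoid.GMul.mul (A := fun i => PowStalk L i p) (a • s) (b • t) =
            (a * b) • GradedMonoid.GMul.mul (A := fun i => PowStalk L i p) s t := by
        intro a b s t
        rw [TensorPower.gMul_def, TensorPower.gMul_def, TensorProduct.smul_tmul_smul, map_smul]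
      rw [this, TensorPower.tprod_mul_tprod]
      simp only [map_smul, powTrivialization_tprod, smul_eq_mul]
      rw [Fin.prod_univ_add]
      simp only [Fin.append_left, Fin.append_right]
      ring
    | add x y hx hy =>
      rw [TensorPower.gMul_def] at *
      rw [TensorProduct.tmul_add, map_add, map_add, hx, hy, map_add, mul_add]
  | add x y hx hy =>
    rw [TensorPower.gMul_def] at *
    rw [TensorProduct.add_tmul, map_add, map_add, hx, hy, map_add, add_mul]

lemma powTrivialization_algebraMap₀_one :
    powTrivialization φ 0 (TensorPower.algebraMap₀ 1) = 1 := by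
  rw [TensorPower.algebraMap₀_one, TensorPower.gOne_def, powTrivialization_tprod]
  rfl

lemma powTrivialization_injective (k : ℕ) : Function.Injective (powTrivialization φ k) := by
  -- The tensor power is generated by the power of a generator of `L_p`, which is mapped to `1`.
  have h : ∀ s : PowStalk L k p, s = powTrivialization φ k s •
      PiTensorProduct.tprod (X.presheaf.stalk p) (fun _ : Fin k => φ.symm 1) := by
    intro s
    induction s using PiTensorProduct.induction_on with
    | smul_tprod a m =>
      rw [map_smul, powTrivialization_tprod, smul_eq_mul, mul_smul, ← MultilinearMap.map_smul_univ]
      congr 2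
      ext i
      rw [← map_smul, smul_eq_mul, mul_one, LinearEquiv.symm_apply_apply]
    | add x y hx hy => rw [map_add, add_smul, ← hx, ← hy]
  intro s t hst
  rw [h s, h t, hst]

/-- Two trivializations of a stalk differ by a unit, and the induced trivializations of its tensor
powers by the powers of this unit. -/
lemma exists_powTrivialization_eq (θ : Stalk L p ≃ₗ[X.presheaf.stalk p] X.presheaf.stalk p) :
    ∃ c : X.presheaf.stalk p, IsUnit c ∧ ∀ (k : ℕ) (s : PowStalk L k p),
      powTrivialization φ k s = c ^ k * powTrivialization θ k s := by
  have hφ : ∀ m, φ m = φ (θ.symm 1) * θ m := by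
    intro m
    rw [mul_comm, ← smul_eq_mul, ← map_smul, ← map_smul, smul_eq_mul, mul_one,
      LinearEquiv.symm_apply_apply]
  refine ⟨φ (θ.symm 1), ?_, fun k s => ?_⟩
  · refine .of_mul_eq_one (θ (φ.symm 1)) ?_
    rw [← hφ, LinearEquiv.apply_symm_apply]
  · induction s using PiTensorProduct.induction_on with
    | smul_tprod a m =>
      simp only [map_smul, powTrivialization_tprod, smul_eq_mul]
      rw [Finset.prod_congr rfl fun i _ => hφ (m i), Finset.prod_mul_distrib, Finset.prod_const,
        Finset.card_univ, Fintype.card_fin]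
      ring
    | add x y hx hy => rw [map_add, map_add, hx, hy, mul_add]

/-- In the trivialization given by a generator, a section of a tensor power of `L` is locally a
function. -/
lemma IsGenerator.exists_powTrivialization_eq_germ [X.Over (Spec (.of ℂ))] {U : X.Opens}
    {e : Γ(L, U)} (he : IsGenerator e) {k : ℕ} {s : ∀ x : X, PowStalk L k x}
    (hs : s ∈ powSections L k) {x : X} (hx : x ∈ U) :
    ∃ (V : X.Opens) (hV : V ≤ U), x ∈ V ∧ ∃ h : Γ(X, V), ∀ (y : X) (hy : y ∈ V),
      powTrivialization (he.stalkEquiv y (hV hy)) k (s y) = X.presheaf.germ V y hy h := by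
  obtain ⟨V, hxV, m, a, t, hst⟩ := hs x
  choose h hh using fun j i => he.exists_stalkEquiv_eq_germ (V := V ⊓ U) inf_le_right
    (L.presheaf.map (homOfLE inf_le_left).op (t j i))
  refine ⟨V ⊓ U, inf_le_right, ⟨hxV, hx⟩,
    ∑ j, X.presheaf.map (homOfLE inf_le_left).op (a j) * ∏ i, h j i, fun y hy => ?_⟩
  rw [hst y hy.1, germTensor, map_sum, map_sum]
  refine Finset.sum_congr rfl fun j _ => ?_
  rw [map_smul, powTrivialization_tprod, map_mul, map_prod, smul_eq_mul,
    X.presheaf.germ_res_apply]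
  congr 1
  refine Finset.prod_congr rfl fun i _ => ?_
  rw [← hh j i y hy, secGerm_res]
  rfl

end PowTrivialization

section GenericPoint

variable {X : Scheme.{0}} [IsIntegral X] [X.Over (Spec (.of ℂ))] {L : X.Modules}

/-- A trivialization of `L` at a point `p` extends to a compatible trivialization at the generic
point. -/
lemma IsLineBundle.exists_injective_generic (hL : IsLineBundle L) {p : X}
    (φ : Stalk L p ≃ₗ[X.presheaf.stalk p] X.presheaf.stalk p) (k : ℕ) :
    ∃ ψ : PowStalk L k (genericPoint X) →ₗ[X.presheaf.stalk (genericPoint X)] X.functionField,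
      Function.Injective ψ ∧ ∀ s ∈ powSections L k,
        ψ (s (genericPoint X)) =
          algebraMap (X.presheaf.stalk p) X.functionField (powTrivialization φ k (s p)) := by
  obtain ⟨U, hpU, e, he⟩ := hL.exists_generator p
  have hη : ∀ {V : X.Opens}, p ∈ V → genericPoint X ∈ V := fun {V} hpV =>
    ((genericPoint_spec X).mem_open_set_iff V.isOpen).2 ⟨p, trivial, hpV⟩
  obtain ⟨c, hc, hφ⟩ := exists_powTrivialization_eq φ (he.stalkEquiv p hpU)
  refine ⟨(algebraMap (X.presheaf.stalk p) X.functionField c) ^ k •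
    powTrivialization (he.stalkEquiv (genericPoint X) (hη hpU)) k, ?_, fun s hs => ?_⟩
  · intro s t hst
    rw [LinearMap.smul_apply, LinearMap.smul_apply] at hst
    have hu := (hc.map (algebraMap (X.presheaf.stalk p) X.functionField)).pow k
    exact powTrivialization_injective _ k (hu.mul_left_cancel hst)
  · obtain ⟨V, hV, hpV, h, hh⟩ := he.exists_powTrivialization_eq_germ hs hpU
    have : Nonempty V := ⟨⟨p, hpV⟩⟩
    rw [LinearMap.smul_apply, hh _ (hη hpV), hφ, hh p hpV, map_mul, map_pow, smul_eq_mul,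
      Scheme.algebraMap_germ_eq_germToFunctionField]

/-- A section of a tensor power of a line bundle that vanishes at the generic point is zero. -/
lemma IsLineBundle.eq_zero_of_generic (hL : IsLineBundle L) {k : ℕ} {s : ∀ x : X, PowStalk L k x}
    (hs : s ∈ powSections L k) (h0 : s (genericPoint X) = 0) : s = 0 := by
  funext x
  obtain ⟨U, hxU, e, he⟩ := hL.exists_generator x
  obtain ⟨ψ, -, hψ⟩ := hL.exists_injective_generic (he.stalkEquiv x hxU) k
  have h := hψ s hs
  rw [h0, map_zero] at h
  have h1 := IsFractionRing.injective (X.presheaf.stalk x) X.functionField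
    (h.symm.trans (map_zero _).symm)
  exact powTrivialization_injective _ k (h1.trans (map_zero _).symm)

end GenericPoint

/-! ### The value semigroup of a graded linear series -/

section LinearSeries

variable {X : Scheme.{0}} [X.Over (Spec (.of ℂ))] {L : X.Modules} (W : GradedLinearSeries L) {p : X}
  (φ : Stalk L p ≃ₗ[X.presheaf.stalk p] X.presheaf.stalk p)

/-- The elements of `W_k`, regarded as elements of the local ring at `p`. -/
noncomputable def GradedLinearSeries.localSeries (k : ℕ) : Submodule ℂ (X.presheaf.stalk p) :=
  (W.W k).map ((powTrivialization φ k).restrictScalars ℂ ∘ₗ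
    LinearMap.proj (R := ℂ) (φ := fun x : X => PowStalk L k x) p)

lemma GradedLinearSeries.localSeries_zero :
    W.localSeries φ 0 = Submodule.span ℂ {1} := by
  rw [localSeries, W.zero_eq, Submodule.map_span, Set.image_singleton]
  congr 2
  exact powTrivialization_algebraMap₀_one φ

lemma GradedLinearSeries.mul_mem_localSeries {j k : ℕ} {f g : X.presheaf.stalk p}
    (hf : f ∈ W.localSeries φ j) (hg : g ∈ W.localSeries φ k) :
    f * g ∈ W.localSeries φ (j + k) := by
  obtain ⟨s, hs, rfl⟩ := hf
  obtain ⟨t, ht, rfl⟩ := hg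
  exact ⟨_, W.mul_mem hs ht, powTrivialization_mulEquiv φ (s p) (t p)⟩

variable [IsIntegral X]

lemma GradedLinearSeries.powTrivialization_ne_zero (hL : IsLineBundle L) {k : ℕ}
    {s : ∀ x : X, PowStalk L k x} (hs : s ∈ W.W k) (h0 : s ≠ 0) :
    powTrivialization φ k (s p) ≠ 0 := by
  intro h
  obtain ⟨ψ, hψ, hψs⟩ := hL.exists_injective_generic φ k
  have h1 := hψs s (W.le_sections k hs)
  rw [h, map_zero] at h1
  exact h0 (hL.eq_zero_of_generic (W.le_sections k hs) (hψ (h1.trans (map_zero ψ).symm)))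

/-- The rational functions `f / g` with `f, g ∈ W_k` may be computed in the local ring at `p`. -/
lemma GradedLinearSeries.ratios_eq (hL : IsLineBundle L) (k : ℕ) :
    W.ratios k = {x : X.functionField | ∃ f ∈ W.localSeries φ k, ∃ g ∈ W.localSeries φ k, g ≠ 0 ∧
      algebraMap (X.presheaf.stalk p) X.functionField f =
        x * algebraMap (X.presheaf.stalk p) X.functionField g} := by
  obtain ⟨ψ, hψ, hψs⟩ := hL.exists_injective_generic φ k
  ext c
  constructor
  · rintro ⟨s, hs, t, ht, ht0, h⟩
    refine ⟨_, ⟨s, hs, rfl⟩, _, ⟨t, ht, rfl⟩, W.powTrivialization_ne_zero φ hL ht ht0, ?_⟩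
    have := congrArg ψ h
    rw [map_smul, hψs s (W.le_sections k hs), hψs t (W.le_sections k ht)] at this
    exact this
  · rintro ⟨_, ⟨s, hs, rfl⟩, _, ⟨t, ht, rfl⟩, ht0, h⟩
    refine ⟨s, hs, t, ht, ?_, hψ ?_⟩
    · rintro rfl
      exact ht0 (map_zero _)
    · rw [map_smul, hψs s (W.le_sections k hs), hψs t (W.le_sections k ht)]
      exact h

lemma GradedLinearSeries.localSeries_ne_bot (hL : IsLineBundle L) {k : ℕ} (h : W.W k ≠ ⊥) :
    W.localSeries φ k ≠ ⊥ := by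
  obtain ⟨s, hs, h0⟩ := (W.W k).ne_bot_iff.1 h
  exact (Submodule.ne_bot_iff _).2 ⟨_, ⟨s, hs, rfl⟩, W.powTrivialization_ne_zero φ hL hs h0⟩

end LinearSeries

end GradedSeries

theorem mainTheorem6 (X : Scheme.{0}) [X.Over (Spec (.of ℂ))] [IsComplexVariety X]
    (L : X.Modules) (hL : IsLineBundle L) (W : GradedLinearSeries L) (hW : W.IsBirational)
    (n : ℕ) (hpt : n = 0 → ∀ᶠ k in atTop, W.W k ≠ ⊥)
    (p : X) (hp : IsSmoothPoint p)
    (z : Fin n → X.presheaf.stalk p) (hz : IsLocalCoordinates p z)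
    (ord : MonomialOrder (Fin n))
    (φ : Stalk L p ≃ₗ[X.presheaf.stalk p] X.presheaf.stalk p) :
    IsBirationalSemigroup (W.valueSemigroup ord z φ) := by
  have hcoord := IsLocalCoordinates.isCoordinateSystem X hp.1 hz
  have h := isBirationalSemigroup_values hcoord ord (K := X.functionField)
    (W.localSeries_zero φ) (W.mul_mem_localSeries φ)
    (hW.mono fun k hk => by rwa [W.ratios_eq φ hL] at hk)
    fun hn => (hpt hn).mono fun k hk => W.localSeries_ne_bot φ hL hk
  convert h using 1
  ext a
  constructor
  · rintro ⟨s, hs, -, hv⟩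
    exact ⟨_, ⟨s, hs, rfl⟩, hv⟩
  · rintro ⟨_, ⟨s, hs, rfl⟩, hv⟩
    refine ⟨s, hs, ?_, hv⟩
    rintro rfl
    exact HasValue.ne_zero hcoord hv (map_zero _)
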